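/- **Setting.** Let $n\ge 0$ and $d\ge 2$ be integers, let $\beta>0$, and let $p\in\mathbb R[x_1,\dots,x_n]$ be a $\beta$-smooth polynomial of degree (at most) $d$: for every $0\le l\le d$, each degree-$l$ monomial of $p$ has a coefficient of absolute value at most $\beta n^{d-l}$. Let $(p_I)$, indexed by the tuples $I$ over $[n]$ of length at most $d$, be any hierarchical decomposition of $p$: $p_\emptyset=p$; each $p_I$ is $\beta$-smooth of degree at most $d-|I|$; and $p_I=c_I+\sum_{j\in[n]}x_j\,p_{I,j}$ for $|I|<d$, where $c_I$ is the constant term of $p_I$. (Such a decomposition always exists: successively for $i=1,\dots,n$, collect the remaining terms of $p$ that contain $x_i$, divide them by $x_i$ to get $p_i$, and recurse.) Put $c=c_\emptyset$. Let $x^*$ maximize $p$ over $\{0,1\}^n$, let $\hat x\in\{0,1\}^n$ be a prediction, and let $\varepsilon=\|\hat x-x^*\|_1$. Put $q_I(x)=c_I+\sum_{j}x_j\,p_{I,j}(\hat x)$, and let $y$ be an optimal solution of the linear program $$\max_x\ c+\sum_{j\in[n]}x_j\,p_j(\hat x)\quad\text{s.t.}\quad |q_I(x)-p_I(\hat x)|\le\delta_I\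 \text{ for all } I \text{ with } 1\le|I|\le d-1,\qquad x\in[0,1]^n,$$ where the tolerances are either $\delta_I=2\beta e\,n^{d-|I|-1/2}\sqrt{\varepsilon}$ for $|I|<d-1$ and $\delta_I=\beta\sqrt{n\varepsilon}$ for $|I|=d-1$, or $\delta_I=|q_I(x^*)-p_I(\hat x)|$ for all $I$. Put $$\eta=2e(d-2)+1,\qquad \kappa=\eta\ \text{ if } d\ge3,\qquad \kappa=3\ \text{ if } d=2 .$$ **Theorem.** 1. Let $z\in\{0,1\}^n$ be obtained from $y$ by independent randomized rounding: the coordinates $z_i$ are independent and $\Pr[z_i=1]=y_i$. Then for every real $k$, with probability at least $1-2d/n^{k-d+2}$, $$p(z)\ \ge\ p(x^*)-2\eta\beta\, n^{d-1/2}\sqrt{\varepsilon}-\kappa\beta\, n^{d-1}\sqrt{\tfrac{k+1}{2}}\,\sqrt{n\ln n}.$$ 2. If $p$ is multilinear, that is, affine in each variable when the others are fixed, and $z$ is obtained from $y$ by greedy deterministic rounding, that is, for $i=1,\dots,n$ in turn $z_i$ is a maximizer over $t\in\{0,1\}$ of $p(z_1,\dots,z_{i-1},t,y_{i+1},\dots,y_n)$,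 ties broken arbitrarily, then $$p(z)\ \ge\ p(x^*)-2\eta\beta\, n^{d-1/2}\sqrt{\varepsilon}.$$ (For $k\le d-2$ and $n\ge1$ the probability bound in 1 is at most $0$ and part 1 says nothing, so the square root of a negative number for $k<-1$ plays no role; for $n=0$ read the error terms as $0$.) -/

import Mathlib

open MvPolynomial MeasureTheory ProbabilityTheory

namespace SmoothIP

noncomputable section

/-- `p` is a `β`-smooth polynomial of degree (at most) `d` in `n` variables: the coefficient of
every monomial of degree `l ≤ d` is at most `β * n ^ (d - l)` in absolute value. -/
def IsSmooth {n : ℕ} (β : ℝ) (d : ℕ) (p : MvPolynomial (Fin n) ℝ) : Prop :=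
  p.totalDegree ≤ d ∧
    ∀ m : Fin n →₀ ℕ, m.degree ≤ d → |coeff m p| ≤ β * (n : ℝ) ^ (d - m.degree)

/-- A hierarchical decomposition of `p`.  The polynomial `P I` attached to the index tuple `I`
satisfies `p_I = c_I + ∑ j, x_j * p_{I,j}` with the constant term `c_I = constantCoeff (P I)`, and
it is `β`-smooth of degree `d - |I|`.  The root, `I = []`, is `p` itself. -/
structure IsDecomposition {n : ℕ} (β : ℝ) (d : ℕ) (p : MvPolynomial (Fin n) ℝ)
    (P : List (Fin n) → MvPolynomial (Fin n) ℝ) : Prop where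
  root : P [] = p
  step : ∀ I : List (Fin n), I.length < d →
    P I = C (constantCoeff (P I)) + ∑ j, X j * P (I ++ [j])
  smooth : ∀ I : List (Fin n), I.length ≤ d → IsSmooth β (d - I.length) (P I)

/-- One step of the subroutine `Decompose`: after all terms containing some `x_j`, `j < i`, have
been removed from `p`, the coefficient of `x_i` in the remainder, that is, the sum of the remaining
terms that contain `x_i`, divided by `x_i`. -/
def peel {n : ℕ} (i : Fin n) (p : MvPolynomial (Fin n) ℝ) : MvPolynomial (Fin n) ℝ :=
  ∑ m ∈ p.support with m i ≠ 0 ∧ ∀ j < i, m j = 0,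
    monomial (m - Finsupp.single i 1) (coeff m p)

/-- All components `p_I` that the subroutine `Decompose` computes. -/
def decompose {n : ℕ} (p : MvPolynomial (Fin n) ℝ) (I : List (Fin n)) :
    MvPolynomial (Fin n) ℝ :=
  I.foldl (fun q i => peel i q) p

/-- The linear approximation `q_I(x) = c_I + ∑ j, x_j * p_{I,j}(xhat)` of `p_I`. -/
def linearization {n : ℕ} (P : List (Fin n) → MvPolynomial (Fin n) ℝ) (xhat : Fin n → ℝ)
    (I : List (Fin n)) (x : Fin n → ℝ) : ℝ :=
  constantCoeff (P I) + ∑ j, x j * eval xhat (P (I ++ [j]))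

def IsBinary {n : ℕ} (x : Fin n → ℝ) : Prop :=
  ∀ i, x i = 0 ∨ x i = 1

/-- `x` solves the integer program: maximize `p` over `{0,1}^n`. -/
def IsOptimalIP {n : ℕ} (p : MvPolynomial (Fin n) ℝ) (x : Fin n → ℝ) : Prop :=
  IsBinary x ∧ ∀ x' : Fin n → ℝ, IsBinary x' → eval x' p ≤ eval x p

/-- The prediction error `‖xhat - xstar‖₁`. -/
def l1Error {n : ℕ} (xhat xstar : Fin n → ℝ) : ℝ :=
  ∑ i, |xhat i - xstar i|

/-- The tolerances `δ_I = |q_I(xstar) - p_I(xhat)|`. -/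
def deviationTolerance {n : ℕ} (P : List (Fin n) → MvPolynomial (Fin n) ℝ)
    (xhat xstar : Fin n → ℝ) (I : List (Fin n)) : ℝ :=
  |linearization P xhat I xstar - eval xhat (P I)|

/-- The tolerances `δ_I` that the subroutine `Relax` computes from the error budget `ε`. -/
def relaxTolerance (n d : ℕ) (β ε : ℝ) (I : List (Fin n)) : ℝ :=
  if I.length < d - 1 then
    2 * β * Real.exp 1 * (n : ℝ) ^ ((d : ℝ) - I.length - 1 / 2) * √ε
  else β * √(n * ε)

/-- The feasible set of the oracle-linearized program: `x ∈ [0,1]^n` and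
`q_I(x) ∈ p_I(xhat) ± δ_I` for all index tuples `I` with `1 ≤ |I| ≤ d - 1`. -/
def feasibleLP {n : ℕ} (d : ℕ) (P : List (Fin n) → MvPolynomial (Fin n) ℝ) (xhat : Fin n → ℝ)
    (δ : List (Fin n) → ℝ) : Set (Fin n → ℝ) :=
  {x | (∀ i, x i ∈ Set.Icc (0 : ℝ) 1) ∧
    ∀ I : List (Fin n), 1 ≤ I.length → I.length ≤ d - 1 →
      linearization P xhat I x ∈ Set.Icc (eval xhat (P I) - δ I) (eval xhat (P I) + δ I)}

/-- `y` is an optimal solution of the oracle-linearized program, whose objective is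
`c + ∑ j, x_j * p_j(xhat)`. -/
def IsOptimalLP {n : ℕ} (d : ℕ) (P : List (Fin n) → MvPolynomial (Fin n) ℝ) (xhat : Fin n → ℝ)
    (δ : List (Fin n) → ℝ) (y : Fin n → ℝ) : Prop :=
  y ∈ feasibleLP d P xhat δ ∧
    ∀ x ∈ feasibleLP d P xhat δ, linearization P xhat [] x ≤ linearization P xhat [] y

/-- The random vector `z` arises from `y` by independent randomized rounding: its coordinates are
independent, `{0,1}`-valued, and the `i`-th one equals `1` with probability `y i`. -/
structure IsRandomizedRounding {n : ℕ} {Ω : Type*} [MeasurableSpace Ω] (μ : Measure Ω)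
    (y : Fin n → ℝ) (z : Ω → Fin n → ℝ) : Prop where
  measurable : ∀ i, Measurable fun ω => z ω i
  binary : ∀ᵐ ω ∂μ, IsBinary (z ω)
  prob : ∀ i, μ.real {ω | z ω i = 1} = y i
  indep : iIndepFun (fun i ω => z ω i) μ

/-- `p` is affine in each variable when the other variables are held fixed. -/
def IsMultilinear {n : ℕ} (p : MvPolynomial (Fin n) ℝ) : Prop :=
  ∀ (i : Fin n) (x : Fin n → ℝ), ∃ a b : ℝ, ∀ t : ℝ, eval (Function.update x i t) p = a * t + b

/-- `z` is an output of greedy deterministic rounding of `y`: for `i = 1, …, n` in turn, `z i` is a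
maximizer of `p (z_1, …, z_{i-1}, t, y_{i+1}, …, y_n)` over `t ∈ {0,1}` (ties broken
arbitrarily). -/
def IsGreedyRounding {n : ℕ} (p : MvPolynomial (Fin n) ℝ) (y z : Fin n → ℝ) : Prop :=
  IsBinary z ∧ ∀ i : Fin n, ∀ t : ℝ, t = 0 ∨ t = 1 →
    eval (fun j => if j < i then z j else if j = i then t else y j) p ≤
      eval (fun j => if j < i then z j else if j = i then z i else y j) p

/-- `η = 2e(d - 2) + 1`. -/
def eta (d : ℕ) : ℝ := 2 * Real.exp 1 * ((d : ℝ) - 2) + 1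

/-- The constant of the randomized-rounding loss: `η` for `d ≥ 3`, and `3` for `d = 2`. -/
def roundingConst (d : ℕ) : ℝ := if d = 2 then 3 else eta d

theorem coeff_peel {n : ℕ} (i : Fin n) (p : MvPolynomial (Fin n) ℝ) (m : Fin n →₀ ℕ) :
    coeff m (peel i p) =
      if ∀ j < i, m j = 0 then coeff (m + Finsupp.single i 1) p else 0 := by
  classical
  unfold peel
  rw [coeff_sum]
  simp only [coeff_monomial]
  have key : ∀ a : Fin n →₀ ℕ, a i ≠ 0 → (a - Finsupp.single i 1 = m ↔
      a = m + Finsupp.single i 1) := by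
    intro a ha
    have hle : Finsupp.single i 1 ≤ a := by
      rw [Finsupp.single_le_iff]; omega
    exact tsub_eq_iff_eq_add_of_le hle
  rw [Finset.sum_congr rfl (g := fun a => if a = m + Finsupp.single i 1 then coeff a p else 0)
    (by
      intro a ha
      simp only [Finset.mem_filter] at ha
      simp only [key a ha.2.1])]
  rw [Finset.sum_ite_eq']
  have hm : (∀ j < i, (m + Finsupp.single i 1 : Fin n →₀ ℕ) j = 0) ↔ ∀ j < i, m j = 0 := by
    refine forall₂_congr fun j hj => ?_
    rw [Finsupp.add_apply, Finsupp.single_eq_of_ne hj.ne, add_zero]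
  simp only [Finset.mem_filter, hm]
  by_cases h : ∀ j < i, m j = 0
  · by_cases h0 : coeff (m + Finsupp.single i 1) p = 0
    · simp [h0]
    · have : m + Finsupp.single i 1 ∈ p.support := by simpa [mem_support_iff] using h0
      simp [this]
  · simp [h]

theorem eq_C_add_sum_X_mul_peel {n : ℕ} (p : MvPolynomial (Fin n) ℝ) :
    p = C (constantCoeff p) + ∑ j, X j * peel j p := by
  classical
  ext m
  simp only [coeff_add, coeff_C, coeff_sum, coeff_X_mul', coeff_peel]
  by_cases hm : m = 0
  · subst hm; simp [constantCoeff_eq]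
  rw [if_neg (Ne.symm hm), zero_add]
  have hne : m.support.Nonempty := Finsupp.support_nonempty_iff.2 hm
  set i := m.support.min' hne with hi
  have him : i ∈ m.support := Finset.min'_mem _ _
  rw [Finset.sum_eq_single i]
  · have hle : Finsupp.single i 1 ≤ m := by
      rw [Finsupp.single_le_iff]
      have := Finsupp.mem_support_iff.1 him
      omega
    rw [if_pos him, if_pos, tsub_add_cancel_of_le hle]
    intro j hj
    have : j ∉ m.support := fun h => absurd (Finset.min'_le _ _ h) (not_le.2 hj)
    simp [Finsupp.notMem_support_iff.1 this]
  · intro j _ hji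
    split_ifs with h1 h2
    · exfalso
      have hlt : i < j := lt_of_le_of_ne (Finset.min'_le _ _ h1) (Ne.symm hji)
      have := h2 i hlt
      rw [Finsupp.tsub_apply, Finsupp.single_eq_of_ne hlt.ne] at this
      exact Finsupp.mem_support_iff.1 him (by simpa using this)
    · rfl
    · rfl
  · simp

theorem IsSmooth.peel {n : ℕ} {β : ℝ} {d : ℕ} (hβ : 0 < β) {p : MvPolynomial (Fin n) ℝ}
    (hp : IsSmooth β (d + 1) p) (i : Fin n) : IsSmooth β d (peel i p) := by
  classical
  have hdeg : ∀ m : Fin n →₀ ℕ, (m + Finsupp.single i 1).degree = m.degree + 1 := by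
    intro m; simp
  refine ⟨?_, fun m hm => ?_⟩
  · refine Finset.sup_le fun m hm => ?_
    have hc : coeff (m + Finsupp.single i 1) p ≠ 0 := by
      intro h
      rw [mem_support_iff, coeff_peel, h] at hm
      simp at hm
    have h1 := le_totalDegree (mem_support_iff.2 hc)
    have h2 : ((m + Finsupp.single i 1).sum fun _ e => e) = (m.sum fun _ e => e) + 1 := hdeg m
    have h3 := hp.1
    omega
  · rw [coeff_peel]
    split_ifs
    · have := hp.2 (m + Finsupp.single i 1) (by rw [hdeg]; omega)
      rwa [hdeg, Nat.add_sub_add_right] at this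
    · rw [abs_zero]; positivity

/-- The components that the subroutine `Decompose` computes form a hierarchical decomposition. -/
theorem isDecomposition_decompose {n : ℕ} {β : ℝ} {d : ℕ} (hβ : 0 < β)
    {p : MvPolynomial (Fin n) ℝ} (hp : IsSmooth β d p) :
    IsDecomposition β d p (decompose p) where
  root := rfl
  step I _ := by
    simp only [decompose, List.foldl_append, List.foldl_cons, List.foldl_nil]
    exact eq_C_add_sum_X_mul_peel _
  smooth I := by
    induction I using List.reverseRecOn with
    | nil => intro _; simpa [decompose] using hp
    | append_singleton I j ih =>
      intro h
      simp only [List.length_append, List.length_singleton] at h ⊢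
      have h1 := ih (by omega)
      rw [show d - I.length = (d - (I.length + 1)) + 1 by omega] at h1
      simpa only [decompose, List.foldl_append, List.foldl_cons, List.foldl_nil] using
        h1.peel hβ j

end

end SmoothIP

namespace SmoothIP

/-! For `n ≥ 2` there are at most `(l + 1) (n/2)^l` monomials of degree `l`, so on the unit cube a
`β`-smooth polynomial of degree `D` is at most `V_D β n^D` in absolute value, where `V_D =
valueConst D ≤ 4 < 2e` and `V_0 = 1` (`IsSmooth.abs_eval_le`).

Write `m = d - |I| - 1` and `S = √(nε)`. Since `ε ≤ n` gives `ε ≤ S`, this value bound makes `x*`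
feasible for either choice of tolerances, all of which are at most `2e β n^m S`, or `β S` when `m =
0`. At a feasible `x`, `|p_I(x) - p_I(x̂)|` is at most `δ_I` plus `n` times the largest such gap
among the children `p_{I,j}`. Unrolling this bounds the gap between `p` and the LP objective by `η β
n^{d-1} S`. Paying it at `x*` and at `y` costs `2η` (`IsDecomposition.eval_le_eval_add`).

Randomized rounding follows the same tree. Hoeffding's inequality controls the linear forms with
fixed weights `p_{I,j}(y)`, a union bound covers all tuples, and the constants add up to `V_0 + ...
+ V_{d-1} ≤ κ`. Greedy rounding loses nothing, because an affine function on `[0,1]` is maximal at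
an endpoint. The cases `n ≤ 1`, where the monomial count fails, are treated directly. -/

/-! ### Monomial counts and values of smooth polynomials on the cube -/

theorem multichoose_mul_two_pow_le {n : ℕ} (hn : 2 ≤ n) (l : ℕ) :
    n.multichoose l * 2 ^ l ≤ (l + 1) * n ^ l := by
  induction l with
  | zero => simp
  | succ l ih =>
    have hrec : (l + 1) * n.multichoose (l + 1) = (n + l) * n.multichoose l := by
      obtain ⟨m, rfl⟩ : ∃ m, n = m + 1 := ⟨n - 1, by omega⟩
      rw [Nat.multichoose_eq, Nat.multichoose_eq]
      have h := Nat.add_one_mul_choose_eq (m + l) l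
      rw [show m + 1 + (l + 1) - 1 = m + l + 1 by omega, show m + 1 + l - 1 = m + l by omega,
        show m + 1 + l = m + l + 1 by omega, h, mul_comm]
    refine Nat.le_of_mul_le_mul_left ?_ (Nat.succ_pos l)
    calc (l + 1) * (n.multichoose (l + 1) * 2 ^ (l + 1))
        = 2 * (n + l) * (n.multichoose l * 2 ^ l) := by rw [← mul_assoc, hrec]; ring
      _ ≤ 2 * (n + l) * ((l + 1) * n ^ l) := Nat.mul_le_mul_left _ ih
      _ = (l + 1) * n ^ l * (2 * n + 2 * l) := by ring
      -- The only use of `2 ≤ n`: it absorbs `2 * l` into `n * l`.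
      _ ≤ (l + 1) * n ^ l * (2 * n + n * l) := by gcongr
      _ = (l + 1) * ((l + 1 + 1) * n ^ (l + 1)) := by ring

/-- The constant in the bound `|p x| ≤ valueConst D * β * n ^ D` for `β`-smooth polynomials `p`
of degree `D` and points `x` of the unit cube. -/
noncomputable def valueConst (D : ℕ) : ℝ := ∑ l ∈ Finset.range (D + 1), ((l : ℝ) + 1) / 2 ^ l

theorem valueConst_eq (D : ℕ) : valueConst D = 4 - ((D : ℝ) + 3) / 2 ^ D := by
  induction D with
  | zero => norm_num [valueConst]
  | succ D ih =>
    rw [valueConst, Finset.sum_range_succ, ← valueConst, ih]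
    push_cast
    field_simp
    ring

theorem valueConst_pos (D : ℕ) : 0 < valueConst D :=
  Finset.sum_pos (fun _ _ => by positivity) ⟨0, by simp⟩

theorem valueConst_le_four (D : ℕ) : valueConst D ≤ 4 := by
  rw [valueConst_eq]
  have : (0 : ℝ) ≤ ((D : ℝ) + 3) / 2 ^ D := by positivity
  linarith

theorem lt_two_mul_exp_one : (5.4 : ℝ) < 2 * Real.exp 1 := by
  have := Real.exp_one_gt_d9
  linarith

theorem sum_valueConst_le {d : ℕ} (hd : 2 ≤ d) :
    ∑ i ∈ Finset.range d, valueConst i ≤ roundingConst d := by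
  have he := lt_two_mul_exp_one
  rcases hd.eq_or_lt with rfl | hd
  · norm_num [Finset.sum_range_succ, valueConst_eq, roundingConst]
  · rw [roundingConst, if_neg (by omega)]
    -- At `d = 3` the sum is `1 + 2 + 11/4 < 2e + 1`; each further term is at most `4 < 2e`, the
    -- increment of `eta`.
    induction d, hd using Nat.le_induction with
    | base =>
      norm_num [Finset.sum_range_succ, valueConst_eq, eta]
      linarith
    | succ d hd ih =>
      have := ih (by omega)
      have h4 := valueConst_le_four d
      rw [Finset.sum_range_succ]
      unfold eta at *
      push_cast
      linarith

theorem eta_nonneg {d : ℕ} (hd : 2 ≤ d) : 0 ≤ eta d := by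
  have : (2 : ℝ) ≤ d := by exact_mod_cast hd
  have : (0 : ℝ) ≤ d - 2 := by linarith
  unfold eta
  positivity

theorem IsBinary.mem_Icc {n : ℕ} {x : Fin n → ℝ} (hx : IsBinary x) (i : Fin n) :
    x i ∈ Set.Icc (0 : ℝ) 1 := by
  rcases hx i with h | h <;> simp [h]

theorem card_finsuppAntidiag_univ (n l : ℕ) :
    (Finset.finsuppAntidiag (Finset.univ : Finset (Fin n)) l).card = n.multichoose l := by
  simp [Finset.card_finsuppAntidiag_nat_eq_multichoose]

theorem IsSmooth.abs_eval_le {n : ℕ} (hn : 2 ≤ n) {β : ℝ} (hβ : 0 ≤ β) {D : ℕ}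
    {p : MvPolynomial (Fin n) ℝ} (hp : IsSmooth β D p) {x : Fin n → ℝ}
    (hx : ∀ i, x i ∈ Set.Icc (0 : ℝ) 1) :
    |eval x p| ≤ valueConst D * β * (n : ℝ) ^ D := by
  classical
  have hdeg : ∀ m ∈ p.support, m.degree ≤ D := fun m hm =>
    (le_totalDegree hm).trans hp.1
  have hn0 : (0 : ℝ) < n := by exact_mod_cast (by omega : 0 < n)
  calc |eval x p| ≤ ∑ m ∈ p.support, |coeff m p * ∏ i, x i ^ m i| := by
        rw [eval_eq']
        exact Finset.abs_sum_le_sum_abs _ _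
    _ ≤ ∑ m ∈ p.support, β * (n : ℝ) ^ (D - m.degree) := by
        refine Finset.sum_le_sum fun m hm => ?_
        rw [abs_mul, Finset.abs_prod]
        refine (mul_le_of_le_one_right (abs_nonneg _) ?_).trans (hp.2 m (hdeg m hm))
        refine Finset.prod_le_one (fun _ _ => abs_nonneg _) fun i _ => ?_
        rw [abs_of_nonneg (pow_nonneg (hx i).1 _)]
        exact pow_le_one₀ (hx i).1 (hx i).2
    -- Enlarge the support to all exponent vectors of degree at most `D`, sorted by degree so that
    -- they can be counted.
    _ ≤ ∑ m ∈ (Finset.range (D + 1)).biUnion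
          (fun l => Finset.finsuppAntidiag (Finset.univ : Finset (Fin n)) l),
          β * (n : ℝ) ^ (D - m.degree) := by
        refine Finset.sum_le_sum_of_subset_of_nonneg (fun m hm => ?_) fun _ _ _ => by positivity
        refine Finset.mem_biUnion.2 ⟨m.degree, Finset.mem_range.2 (Nat.lt_succ_of_le (hdeg m hm)), ?_⟩
        simp [Finset.mem_finsuppAntidiag, Finsupp.degree_eq_sum]
    _ ≤ ∑ l ∈ Finset.range (D + 1),
          ∑ m ∈ Finset.finsuppAntidiag (Finset.univ : Finset (Fin n)) l,
            β * (n : ℝ) ^ (D - m.degree) := by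
        refine (Finset.sum_biUnion fun l _ l' _ hll' => ?_).le
        refine Finset.disjoint_left.2 fun m hm hm' => hll' ?_
        rw [Finset.mem_finsuppAntidiag] at hm hm'
        exact hm.1.symm.trans hm'.1
    _ = ∑ l ∈ Finset.range (D + 1), (n.multichoose l : ℝ) * (β * (n : ℝ) ^ (D - l)) := by
        refine Finset.sum_congr rfl fun l _ => ?_
        rw [← card_finsuppAntidiag_univ, ← nsmul_eq_mul]
        refine Finset.sum_eq_card_nsmul fun m hm => ?_
        rw [Finset.mem_finsuppAntidiag] at hm
        rw [Finsupp.degree_eq_sum, hm.1]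
    _ ≤ ∑ l ∈ Finset.range (D + 1), (((l : ℝ) + 1) / 2 ^ l) * (β * (n : ℝ) ^ D) := by
        refine Finset.sum_le_sum fun l hl => ?_
        have hl : l ≤ D := Nat.lt_succ_iff.1 (Finset.mem_range.1 hl)
        have h1 : (n.multichoose l : ℝ) ≤ ((l : ℝ) + 1) / 2 ^ l * (n : ℝ) ^ l := by
          rw [div_mul_eq_mul_div, le_div_iff₀ (by positivity)]
          exact_mod_cast multichoose_mul_two_pow_le hn l
        calc _ ≤ ((l : ℝ) + 1) / 2 ^ l * (n : ℝ) ^ l * (β * (n : ℝ) ^ (D - l)) := by gcongr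
          _ = ((l : ℝ) + 1) / 2 ^ l * (β * ((n : ℝ) ^ l * (n : ℝ) ^ (D - l))) := by ring
          _ = _ := by rw [← pow_add, Nat.add_sub_cancel' hl]
    _ = valueConst D * β * (n : ℝ) ^ D := by rw [← Finset.sum_mul, valueConst, mul_assoc]

theorem IsSmooth.eval_eq_eval {n : ℕ} {β : ℝ} {p : MvPolynomial (Fin n) ℝ}
    (hp : IsSmooth β 0 p) (x x' : Fin n → ℝ) : eval x p = eval x' p := by
  rw [totalDegree_eq_zero_iff_eq_C.1 (Nat.le_zero.1 hp.1), eval_C, eval_C]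

/-! ### Error propagation along the decomposition -/

section Decomposition

variable {n d : ℕ} {β : ℝ} {p : MvPolynomial (Fin n) ℝ} {P : List (Fin n) → MvPolynomial (Fin n) ℝ}

theorem IsDecomposition.eval_eq (hP : IsDecomposition β d p P) {I : List (Fin n)}
    (hI : I.length < d) (x : Fin n → ℝ) :
    eval x (P I) = constantCoeff (P I) + ∑ j, x j * eval x (P (I ++ [j])) := by
  conv_lhs => rw [hP.step I hI]
  simp

/-- Here and below `m = d - |I| - 1` is the degree bound of the children of `I`; stating it as an
equation avoids truncated subtraction. -/
theorem IsDecomposition.smooth_append (hP : IsDecomposition β d p P) {I : List (Fin n)} {m : ℕ}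
    (hI : I.length + m + 1 = d) (j : Fin n) : IsSmooth β m (P (I ++ [j])) := by
  have h := hP.smooth (I ++ [j]) (by simp; omega)
  rwa [List.length_append, List.length_singleton, show d - (I.length + 1) = m by omega] at h

theorem abs_sum_mul_le {x a : Fin n → ℝ} (hx : ∀ i, x i ∈ Set.Icc (0 : ℝ) 1) {B : ℝ}
    (ha : ∀ i, |a i| ≤ B) : |∑ i, x i * a i| ≤ n * B := by
  calc |∑ i, x i * a i| ≤ ∑ i : Fin n, |x i * a i| := Finset.abs_sum_le_sum_abs _ _
    _ ≤ ∑ _i : Fin n, B := by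
        refine Finset.sum_le_sum fun i _ => ?_
        rw [abs_mul, abs_of_nonneg (hx i).1]
        exact (mul_le_of_le_one_left (abs_nonneg _) (hx i).2).trans (ha i)
    _ = n * B := by simp

theorem IsDecomposition.abs_eval_sub_linearization_le (hP : IsDecomposition β d p P)
    {x xhat : Fin n → ℝ} (hx : ∀ i, x i ∈ Set.Icc (0 : ℝ) 1) {I : List (Fin n)}
    (hI : I.length < d) {B : ℝ}
    (hB : ∀ j, |eval x (P (I ++ [j])) - eval xhat (P (I ++ [j]))| ≤ B) :
    |eval x (P I) - linearization P xhat I x| ≤ n * B := by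
  rw [hP.eval_eq hI, linearization, add_sub_add_left_eq_sub, ← Finset.sum_sub_distrib]
  simp only [← mul_sub]
  exact abs_sum_mul_le hx hB

theorem IsDecomposition.linearization_sub_eval (hP : IsDecomposition β d p P)
    (x xhat : Fin n → ℝ) {I : List (Fin n)} (hI : I.length < d) :
    linearization P xhat I x - eval xhat (P I) =
      ∑ j, (x j - xhat j) * eval xhat (P (I ++ [j])) := by
  rw [hP.eval_eq hI, linearization, add_sub_add_left_eq_sub, ← Finset.sum_sub_distrib]
  simp only [← sub_mul]

/-- If all linearizations at `x` are close to the values at `xhat`, so are the values at `x`. -/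
theorem IsDecomposition.abs_eval_sub_eval_le (hP : IsDecomposition β d p P)
    {x xhat : Fin n → ℝ} (hx : ∀ i, x i ∈ Set.Icc (0 : ℝ) 1) {a S : ℝ}
    (hS : ∀ (I : List (Fin n)) (m : ℕ), 1 ≤ I.length → I.length + m + 1 = d →
      |linearization P xhat I x - eval xhat (P I)| ≤
        (if m = 0 then 1 else a) * β * (n : ℝ) ^ m * S)
    (m : ℕ) (I : List (Fin n)) (hI : 1 ≤ I.length) (hm : I.length + m + 1 = d) :
    |eval x (P I) - eval xhat (P I)| ≤ (a * m + 1) * β * (n : ℝ) ^ m * S := by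
  induction m generalizing I with
  | zero =>
    -- The children have degree 0, hence are constants, and the linearization is exact.
    have h := hP.abs_eval_sub_linearization_le (I := I) (xhat := xhat) hx (by omega) (B := 0)
      fun j => by rw [(hP.smooth_append hm j).eval_eq_eval x xhat, sub_self, abs_zero]
    have h2 := hS I 0 hI hm
    have h3 := abs_sub_le (eval x (P I)) (linearization P xhat I x) (eval xhat (P I))
    simp only [if_true] at h2
    simp only [Nat.cast_zero, mul_zero, zero_add] at h ⊢
    linarith
  | succ m ih =>
    have h := hP.abs_eval_sub_linearization_le (I := I) (xhat := xhat) hx (by omega)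
      fun j => ih (I ++ [j]) (by simp) (by simp; omega)
    have h2 := hS I (m + 1) hI hm
    have h3 := abs_sub_le (eval x (P I)) (linearization P xhat I x) (eval xhat (P I))
    rw [if_neg (Nat.succ_ne_zero m)] at h2
    refine (h3.trans (add_le_add h h2)).trans_eq ?_
    push_cast
    ring

/-- The root carries no constraint, so it adds no tolerance of its own: its error is just `n` times
that of its children, which have `m = d - 2`. -/
theorem IsDecomposition.abs_eval_sub_objective_le (hd : 2 ≤ d) (hP : IsDecomposition β d p P)
    {x xhat : Fin n → ℝ} (hx : ∀ i, x i ∈ Set.Icc (0 : ℝ) 1) {S : ℝ}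
    (hS : ∀ (I : List (Fin n)) (m : ℕ), 1 ≤ I.length → I.length + m + 1 = d →
      |linearization P xhat I x - eval xhat (P I)| ≤
        (if m = 0 then 1 else 2 * Real.exp 1) * β * (n : ℝ) ^ m * S) :
    |eval x p - linearization P xhat [] x| ≤ eta d * β * (n : ℝ) ^ (d - 1) * S := by
  obtain ⟨m, rfl⟩ : ∃ m, d = m + 2 := ⟨d - 2, by omega⟩
  have h := hP.abs_eval_sub_linearization_le (I := []) (xhat := xhat) hx (by simp)
    fun j => hP.abs_eval_sub_eval_le hx hS m ([] ++ [j]) (by simp) (by simp; omega)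
  rw [hP.root] at h
  refine h.trans_eq ?_
  rw [eta, show m + 2 - 1 = m + 1 by omega]
  push_cast
  ring

theorem l1Error_le {x x' : Fin n → ℝ} (hx : IsBinary x) (hx' : IsBinary x') :
    l1Error x x' ≤ n := by
  calc l1Error x x' ≤ ∑ _i : Fin n, (1 : ℝ) := by
        refine Finset.sum_le_sum fun i _ => ?_
        rcases hx i with h | h <;> rcases hx' i with h' | h' <;> norm_num [h, h']
    _ = n := by simp

theorem l1Error_nonneg (x x' : Fin n → ℝ) : 0 ≤ l1Error x x' :=
  Finset.sum_nonneg fun _ _ => abs_nonneg _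

theorem l1Error_le_sqrt {x x' : Fin n → ℝ} (hx : IsBinary x) (hx' : IsBinary x') :
    l1Error x x' ≤ √(n * l1Error x x') := by
  refine Real.le_sqrt_of_sq_le ?_
  rw [sq]
  exact mul_le_mul_of_nonneg_right (l1Error_le hx hx') (l1Error_nonneg _ _)

theorem rpow_sub_half_mul_sqrt (hn : 0 < n) (m : ℕ) {r ε : ℝ} (hr : r = m + 1) :
    (n : ℝ) ^ (r - 1 / 2) * √ε = (n : ℝ) ^ m * √(n * ε) := by
  have hn0 : (0 : ℝ) < n := by exact_mod_cast hn
  rw [Real.sqrt_mul hn0.le, ← mul_assoc, Real.sqrt_eq_rpow (n : ℝ), ← Real.rpow_natCast,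
    ← Real.rpow_add hn0, hr]
  norm_num
  left
  congr 1
  ring

/-- Puts both cases of the tolerance in the form used by the recursion, with common factor `√(n *
ε)`. -/
theorem relaxTolerance_eq (hn : 0 < n) (β ε : ℝ) {I : List (Fin n)} {m : ℕ}
    (hm : I.length + m + 1 = d) :
    relaxTolerance n d β ε I =
      (if m = 0 then 1 else 2 * Real.exp 1) * β * (n : ℝ) ^ m * √(n * ε) := by
  unfold relaxTolerance
  by_cases h : m = 0
  · rw [if_neg (by omega), if_pos h, h]
    ring
  · rw [if_pos (by omega), if_neg h, mul_assoc (2 * β * Real.exp 1),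
      rpow_sub_half_mul_sqrt hn m (by rw [← hm]; push_cast; ring)]
    ring

theorem IsDecomposition.deviationTolerance_le_relaxTolerance (hn : 2 ≤ n) (hβ : 0 ≤ β)
    (hP : IsDecomposition β d p P) {xhat xstar : Fin n → ℝ} (hxhat : IsBinary xhat)
    (hxstar : IsBinary xstar) {I : List (Fin n)} (hI : I.length < d) :
    deviationTolerance P xhat xstar I ≤ relaxTolerance n d β (l1Error xhat xstar) I := by
  obtain ⟨m, hm⟩ : ∃ m, I.length + m + 1 = d := ⟨d - I.length - 1, by omega⟩
  rw [relaxTolerance_eq (by omega) _ _ hm, deviationTolerance, hP.linearization_sub_eval _ _ hI]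
  -- This comparison is why the tolerances carry the factor `2e`, and the factor 1 at the last
  -- level.
  have hV : valueConst m ≤ if m = 0 then 1 else 2 * Real.exp 1 := by
    split_ifs with h
    · subst h; norm_num [valueConst]
    · have := valueConst_le_four m
      have := lt_two_mul_exp_one
      linarith
  calc |∑ j, (xstar j - xhat j) * eval xhat (P (I ++ [j]))|
      ≤ ∑ j, |(xstar j - xhat j) * eval xhat (P (I ++ [j]))| := Finset.abs_sum_le_sum_abs _ _
    _ ≤ ∑ j, |xhat j - xstar j| * (valueConst m * β * (n : ℝ) ^ m) := by
        refine Finset.sum_le_sum fun j _ => ?_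
        rw [abs_mul, abs_sub_comm]
        exact mul_le_mul_of_nonneg_left
          ((hP.smooth_append hm j).abs_eval_le hn hβ hxhat.mem_Icc) (abs_nonneg _)
    _ = valueConst m * β * (n : ℝ) ^ m * l1Error xhat xstar := by
        rw [← Finset.sum_mul, l1Error, mul_comm]
    _ ≤ _ := by
        have := l1Error_le_sqrt hxhat hxstar
        have := l1Error_nonneg xhat xstar
        have := (valueConst_pos m).le
        gcongr

/-- An optimal solution of the oracle-linearized program nearly maximizes the polynomial. -/
theorem IsDecomposition.eval_le_eval_add (hn : 2 ≤ n) (hd : 2 ≤ d) (hβ : 0 ≤ β)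
    (hP : IsDecomposition β d p P) {xhat xstar : Fin n → ℝ} (hxhat : IsBinary xhat)
    (hxstar : IsBinary xstar) {δ : List (Fin n) → ℝ}
    (hδ : δ = relaxTolerance n d β (l1Error xhat xstar) ∨ δ = deviationTolerance P xhat xstar)
    {y : Fin n → ℝ} (hy : IsOptimalLP d P xhat δ y) :
    eval xstar p - 2 * eta d * β * (n : ℝ) ^ ((d : ℝ) - 1 / 2) * √(l1Error xhat xstar) ≤
      eval y p := by
  have hdev := fun (I : List (Fin n)) (hI : I.length < d) =>
    hP.deviationTolerance_le_relaxTolerance hn hβ hxhat hxstar hI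
  have hlow : ∀ I : List (Fin n), I.length < d → deviationTolerance P xhat xstar I ≤ δ I := by
    intro I hI
    rcases hδ with rfl | rfl
    exacts [hdev I hI, le_rfl]
  have hupp : ∀ I : List (Fin n), I.length < d →
      δ I ≤ relaxTolerance n d β (l1Error xhat xstar) I := by
    intro I hI
    rcases hδ with rfl | rfl
    exacts [le_rfl, hdev I hI]
  have hfeas : xstar ∈ feasibleLP d P xhat δ := by
    refine ⟨hxstar.mem_Icc, fun I h1 h2 => ?_⟩
    have h := abs_le.1 (hlow I (by omega))
    constructor <;> linarith [h.1, h.2]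
  have key : ∀ x ∈ feasibleLP d P xhat δ, |eval x p - linearization P xhat [] x| ≤
      eta d * β * (n : ℝ) ^ (d - 1) * √(n * l1Error xhat xstar) := by
    refine fun x hx => hP.abs_eval_sub_objective_le hd hx.1 fun I m h1 h2 => ?_
    rw [← relaxTolerance_eq (by omega) _ _ h2]
    refine le_trans ?_ (hupp I (by omega))
    have h := hx.2 I h1 (by omega)
    rw [abs_le]
    constructor <;> linarith [h.1, h.2]
  have h1 := abs_le.1 (key xstar hfeas)
  have h2 := abs_le.1 (key y hy.1)
  have h3 := hy.2 xstar hfeas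
  have h4 := rpow_sub_half_mul_sqrt (n := n) (by omega) (d - 1) (r := d)
    (ε := l1Error xhat xstar) (by rw [Nat.cast_sub (by omega)]; simp)
  rw [mul_assoc _ (_ ^ _) √_, h4]
  nlinarith [h1.2, h2.1]

/-- The splitting evaluates the weights of the second sum at the fixed point `y`, so for independent
`z j` that sum has independent terms. -/
theorem IsDecomposition.eval_sub_eval (hP : IsDecomposition β d p P) {I : List (Fin n)}
    (hI : I.length < d) (y z : Fin n → ℝ) :
    eval z (P I) - eval y (P I) =
      ∑ j, z j * (eval z (P (I ++ [j])) - eval y (P (I ++ [j]))) +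
        ∑ j, eval y (P (I ++ [j])) * (z j - y j) := by
  rw [hP.eval_eq hI z, hP.eval_eq hI y, add_sub_add_left_eq_sub,
    ← Finset.sum_sub_distrib, ← Finset.sum_add_distrib]
  exact Finset.sum_congr rfl fun j _ => by ring

/-- If all tested linear functions are concentrated at `z`, the values at `z` and `y` are close. -/
theorem IsDecomposition.abs_eval_sub_eval_le_of_concentrated (hP : IsDecomposition β d p P)
    {y z : Fin n → ℝ} (hz : ∀ i, z i ∈ Set.Icc (0 : ℝ) 1) {T : ℝ}
    (hT : ∀ (I : List (Fin n)) (m : ℕ), I.length + m + 1 = d →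
      |∑ j, eval y (P (I ++ [j])) * (z j - y j)| ≤ valueConst m * β * (n : ℝ) ^ m * T)
    (m : ℕ) (I : List (Fin n)) (hm : I.length + m + 1 = d) :
    |eval z (P I) - eval y (P I)| ≤
      (∑ i ∈ Finset.range (m + 1), valueConst i) * β * (n : ℝ) ^ m * T := by
  induction m generalizing I with
  | zero =>
    have h : ∀ j, eval z (P (I ++ [j])) - eval y (P (I ++ [j])) = 0 := fun j => by
      rw [(hP.smooth_append hm j).eval_eq_eval z y, sub_self]
    rw [hP.eval_sub_eval (by omega)]
    simp only [h, mul_zero, Finset.sum_const_zero, zero_add, Finset.sum_range_one]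
    exact hT I 0 hm
  | succ m ih =>
    have h := abs_sum_mul_le hz fun j => ih (I ++ [j]) (by simp; omega)
    rw [hP.eval_sub_eval (by omega)]
    refine (abs_add_le _ _).trans ((add_le_add h (hT I (m + 1) hm)).trans_eq ?_)
    rw [Finset.sum_range_succ _ (m + 1)]
    ring

end Decomposition

/-! ### Greedy rounding -/

section Greedy

variable {n : ℕ} {p : MvPolynomial (Fin n) ℝ}

theorem IsGreedyRounding.eval_le (hp : IsMultilinear p) {y z : Fin n → ℝ}
    (hy : ∀ i, y i ∈ Set.Icc (0 : ℝ) 1) (hz : IsGreedyRounding p y z) :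
    eval y p ≤ eval z p := by
  -- Hybrid argument: replace the coordinates of `y` by those of `z` one at a time.
  have main : ∀ k ≤ n, eval y p ≤ eval (fun j : Fin n => if (j : ℕ) < k then z j else y j) p := by
    intro k
    induction k with
    | zero => simp
    | succ k ih =>
      intro hk
      refine (ih (by omega)).trans ?_
      let i : Fin n := ⟨k, hk⟩
      let f : ℝ → Fin n → ℝ := fun t j => if j < i then z j else if j = i then t else y j
      have hf : ∀ t, f t = Function.update (f 0) i t := by
        intro t
        ext j
        by_cases hj : j = i
        · subst hj; simp [f]
        · simp [f, hj]
      have hz1 : (fun j : Fin n => if (j : ℕ) < k + 1 then z j else y j) = f (z i) := by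
        ext j
        rcases lt_trichotomy j i with hj | hj | hj
        · have : (j : ℕ) < k := hj
          simp [f, hj, this.trans (Nat.lt_succ_self k)]
        · subst hj; simp [f, i]
        · have : ¬ (j : ℕ) < k + 1 := by have : k < (j : ℕ) := hj; omega
          simp [f, hj.not_gt, hj.ne', this]
      have hy1 : (fun j : Fin n => if (j : ℕ) < k then z j else y j) = f (y i) := by
        ext j
        rcases lt_trichotomy j i with hj | hj | hj
        · have : (j : ℕ) < k := hj
          simp [f, hj, this]
        · subst hj; simp [f, i]
        · have : ¬ (j : ℕ) < k := by have : k < (j : ℕ) := hj; omega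
          simp [f, hj.not_gt, hj.ne', this]
      have h0 : eval (f 0) p ≤ eval (f (z i)) p := hz.2 i 0 (Or.inl rfl)
      have h1 : eval (f 1) p ≤ eval (f (z i)) p := hz.2 i 1 (Or.inr rfl)
      -- By affinity the value at `y i` is a convex combination of those at 0 and 1, and `z i` is at
      -- least as good as both.
      obtain ⟨a, b, hab⟩ := hp i (f 0)
      have hev : ∀ t, eval (f t) p = a * t + b := fun t => by rw [hf t, hab]
      rw [hz1, hy1]
      rw [hev] at h0 h1
      rw [hev (y i)]
      nlinarith [(hy i).1, (hy i).2]
  simpa using main n le_rfl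

/-- In at most one variable, greedy rounding maximizes over all binary points. -/
theorem IsGreedyRounding.eval_le_of_le_one (hn : n ≤ 1) {x y z : Fin n → ℝ} (hx : IsBinary x)
    (hz : IsGreedyRounding p y z) : eval x p ≤ eval z p := by
  have : Subsingleton (Fin n) := Fin.subsingleton_iff_le_one.2 hn
  rcases isEmpty_or_nonempty (Fin n) with _ | ⟨⟨i⟩⟩
  · rw [Subsingleton.elim x z]
  · have h := hz.2 i (x i) (hx i)
    have h' : ∀ u : Fin n → ℝ, (fun j => if j < i then z j else if j = i then u i else y j) = u :=
      fun u => funext fun j => by simp [Subsingleton.elim j i]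
    rwa [h' x, h' z] at h

end Greedy

/-! ### Concentration under randomized rounding -/

section Rounding

variable {n : ℕ} {Ω : Type*} [MeasurableSpace Ω] {μ : Measure Ω}
  {y : Fin n → ℝ} {z : Ω → Fin n → ℝ}

theorem IsRandomizedRounding.integral_eq (hz : IsRandomizedRounding μ y z) (i : Fin n) :
    ∫ ω, z ω i ∂μ = y i := by
  have hms : MeasurableSet {ω | z ω i = 1} := hz.measurable i (measurableSet_singleton 1)
  rw [← hz.prob i, ← integral_indicator_one hms]
  refine integral_congr_ae ?_
  filter_upwards [hz.binary] with ω hω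
  rcases hω i with h | h <;> simp [Set.indicator, h]

variable [IsProbabilityMeasure μ]

theorem IsRandomizedRounding.hasSubgaussianMGF (hz : IsRandomizedRounding μ y z) (i : Fin n) :
    HasSubgaussianMGF (fun ω => z ω i - y i) (1 / 4) μ := by
  have h := hasSubgaussianMGF_of_mem_Icc (a := 0) (b := 1) (hz.measurable i).aemeasurable
    (hz.binary.mono fun ω hω => hω.mem_Icc i)
  rw [hz.integral_eq i] at h
  convert h using 1
  ext
  norm_num

theorem IsRandomizedRounding.measureReal_sum_ge_le (hz : IsRandomizedRounding μ y z) (hn : 0 < n)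
    {a : Fin n → ℝ} {A : ℝ} (hA : 0 < A) (ha : ∀ i, |a i| ≤ A) {s : ℝ} (hs : 0 ≤ s) :
    μ.real {ω | A * (√n * s) ≤ ∑ j, a j * (z ω j - y j)} ≤ Real.exp (-2 * s ^ 2) := by
  have hn0 : (0 : ℝ) < n := by exact_mod_cast hn
  have hind : iIndepFun (fun i ω => a i * (z ω i - y i)) μ :=
    hz.indep.comp (fun i t => a i * (t - y i)) fun i => by fun_prop
  have hle : ∀ i, HasSubgaussianMGF (fun ω => a i * (z ω i - y i))
      (.mk (a i ^ 2) (sq_nonneg _) * (1 / 4)) μ := fun i => (hz.hasSubgaussianMGF i).const_mul (a i)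
  -- Weaken the variance proxies to a common one, so that their sum is `n * A ^ 2 / 4`.
  have hmgf : ∀ i, HasSubgaussianMGF (fun ω => a i * (z ω i - y i))
      (.mk (A ^ 2) (sq_nonneg _) * (1 / 4)) μ := fun i =>
    { integrable_exp_mul := (hle i).integrable_exp_mul
      mgf_le := fun t => ((hle i).mgf_le t).trans <| by
        have : a i ^ 2 ≤ A ^ 2 := sq_le_sq' (abs_le.1 (ha i)).1 (abs_le.1 (ha i)).2
        simp only [NNReal.coe_mul, NNReal.coe_mk]
        gcongr }
  refine (HasSubgaussianMGF.measure_sum_ge_le_of_iIndepFun hind (s := Finset.univ)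
    (fun i _ => hmgf i) (by positivity)).trans_eq ?_
  congr 1
  rw [mul_pow, mul_pow, Real.sq_sqrt hn0.le]
  simp
  field_simp
  ring

theorem IsRandomizedRounding.measureReal_abs_sum_ge_le (hz : IsRandomizedRounding μ y z)
    (hn : 0 < n) {a : Fin n → ℝ} {A : ℝ} (hA : 0 < A) (ha : ∀ i, |a i| ≤ A) {s : ℝ}
    (hs : 0 ≤ s) :
    μ.real {ω | A * (√n * s) ≤ |∑ j, a j * (z ω j - y j)|} ≤ 2 * Real.exp (-2 * s ^ 2) := by
  have h1 := hz.measureReal_sum_ge_le hn hA ha hs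
  have h2 := hz.measureReal_sum_ge_le hn (a := fun i => -a i) hA (fun i => by simpa using ha i) hs
  refine (measureReal_mono (fun ω hω => ?_)).trans ((measureReal_union_le _ _).trans
    ((add_le_add h1 h2).trans_eq (two_mul _).symm))
  rcases le_abs.1 (show A * (√n * s) ≤ |∑ j, a j * (z ω j - y j)| from hω) with h | h
  · exact Or.inl h
  · right
    simpa [neg_mul, Finset.sum_neg_distrib] using h

theorem card_sigma_tuple_le (hn : 0 < n) (d : ℕ) :
    (Fintype.card (Σ l : Fin d, Fin l → Fin n) : ℝ) ≤ d * (n : ℝ) ^ (d - 1) := by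
  have hn1 : (1 : ℝ) ≤ n := by exact_mod_cast hn
  rw [Fintype.card_sigma]
  push_cast
  calc ∑ l : Fin d, (Fintype.card (Fin l → Fin n) : ℝ) ≤ ∑ _l : Fin d, (n : ℝ) ^ (d - 1) := by
        refine Finset.sum_le_sum fun l _ => ?_
        simp only [Fintype.card_pi, Fintype.card_fin, Finset.prod_const, Finset.card_univ,
          Nat.cast_pow]
        exact pow_le_pow_right₀ hn1 (by omega)
    _ = _ := by simp

variable {d : ℕ} {β : ℝ} {p : MvPolynomial (Fin n) ℝ} {P : List (Fin n) → MvPolynomial (Fin n) ℝ}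

/-- Randomized rounding loses little with high probability. -/
theorem IsRandomizedRounding.le_measureReal_eval (hn : 2 ≤ n) (hd : 2 ≤ d) (hβ : 0 < β)
    (hP : IsDecomposition β d p P) (hy : ∀ i, y i ∈ Set.Icc (0 : ℝ) 1)
    (hz : IsRandomizedRounding μ y z) {k : ℝ} (hk : 0 ≤ k + 1) :
    1 - 2 * (d : ℝ) / (n : ℝ) ^ (k - d + 2) ≤
      μ.real {ω | eval y p - roundingConst d * β * (n : ℝ) ^ (d - 1) * √((k + 1) / 2)
        * √(n * Real.log n) ≤ eval (z ω) p} := by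
  have hn0 : (0 : ℝ) < n := by exact_mod_cast (by omega : 0 < n)
  have hlog : 0 ≤ Real.log n := Real.log_natCast_nonneg n
  -- Chosen so that the Hoeffding tail `2 * exp (-2 * s ^ 2)` equals `2 / n ^ (k + 1)`.
  set s : ℝ := √((k + 1) / 2) * √(Real.log n) with hs
  have hs0 : 0 ≤ s := by positivity
  have hexp : Real.exp (-2 * s ^ 2) = (n : ℝ) ^ (-(k + 1)) := by
    rw [hs, mul_pow, Real.sq_sqrt (by positivity), Real.sq_sqrt hlog, Real.rpow_def_of_pos hn0]
    congr 1
    ring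
  -- Tuples of length below `d` form a finite type with at most `d * n ^ (d - 1)` elements, which
  -- makes the union bound available.
  let bad : (Σ l : Fin d, Fin l → Fin n) → Set Ω := fun q =>
    {ω | valueConst (d - 1 - q.1) * β * (n : ℝ) ^ (d - 1 - (q.1 : ℕ)) * (√n * s) ≤
      |∑ j, eval y (P (List.ofFn q.2 ++ [j])) * (z ω j - y j)|}
  have hbad : ∀ q, μ.real (bad q) ≤ 2 * (n : ℝ) ^ (-(k + 1)) := by
    intro q
    have hV := valueConst_pos (d - 1 - q.1)
    rw [← hexp]
    refine hz.measureReal_abs_sum_ge_le (by omega) (by positivity) (fun j => ?_) hs0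
    exact (hP.smooth_append (by rw [List.length_ofFn]; omega) j).abs_eval_le hn hβ.le hy
  have hunion : μ.real (⋃ q, bad q) ≤ 2 * (d : ℝ) / (n : ℝ) ^ (k - d + 2) := by
    calc μ.real (⋃ q, bad q) ≤ ∑ q, μ.real (bad q) := measureReal_iUnion_fintype_le _
      _ ≤ ∑ _q : (Σ l : Fin d, Fin l → Fin n), 2 * (n : ℝ) ^ (-(k + 1)) :=
          Finset.sum_le_sum fun q _ => hbad q
      _ = Fintype.card (Σ l : Fin d, Fin l → Fin n) * (2 * (n : ℝ) ^ (-(k + 1))) := by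
          rw [Finset.sum_const, nsmul_eq_mul, Finset.card_univ]
      _ ≤ d * (n : ℝ) ^ (d - 1) * (2 * (n : ℝ) ^ (-(k + 1))) := by
          gcongr
          exact card_sigma_tuple_le (by omega) d
      _ = 2 * d * ((n : ℝ) ^ (d - 1) * (n : ℝ) ^ (-(k + 1))) := by ring
      _ = 2 * (d : ℝ) / (n : ℝ) ^ (k - d + 2) := by
          rw [div_eq_mul_inv, ← Real.rpow_neg hn0.le, ← Real.rpow_natCast, ← Real.rpow_add hn0,
            Nat.cast_sub (by omega)]
          congr 2
          push_cast
          ring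
  set good := {ω | eval y p - roundingConst d * β * (n : ℝ) ^ (d - 1) * √((k + 1) / 2)
        * √(n * Real.log n) ≤ eval (z ω) p} with hgood
  -- A binary outcome avoiding every bad event is good; nonbinary outcomes form a null set.
  have hcover : (Set.univ : Set Ω) ⊆ (good ∪ ⋃ q, bad q) ∪ {ω | ¬ IsBinary (z ω)} := by
    intro ω _
    by_contra hω
    simp only [Set.mem_union, not_or, Set.mem_iUnion, not_exists, Set.mem_ofPred_eq, not_not] at hω
    obtain ⟨⟨hg, hb⟩, hbin⟩ := hω
    refine hg ?_
    have hT : ∀ (I : List (Fin n)) (m : ℕ), I.length + m + 1 = d →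
        |∑ j, eval y (P (I ++ [j])) * (z ω j - y j)| ≤
          valueConst m * β * (n : ℝ) ^ m * (√n * s) := by
      intro I m hm
      have h := hb ⟨⟨I.length, by omega⟩, I.get⟩
      simp only [bad, Set.mem_ofPred_eq, not_le, List.ofFn_get] at h
      rw [show d - 1 - I.length = m by omega] at h
      exact h.le
    have h := hP.abs_eval_sub_eval_le_of_concentrated hbin.mem_Icc hT (d - 1) []
      (by simp; omega)
    rw [hP.root, show d - 1 + 1 = d by omega] at h
    have hle : (∑ i ∈ Finset.range d, valueConst i) * β * (n : ℝ) ^ (d - 1) * (√n * s) ≤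
        roundingConst d * β * (n : ℝ) ^ (d - 1) * (√n * s) := by
      have := sum_valueConst_le hd
      gcongr
    have heq : roundingConst d * β * (n : ℝ) ^ (d - 1) * √((k + 1) / 2) * √(n * Real.log n) =
        roundingConst d * β * (n : ℝ) ^ (d - 1) * (√n * s) := by
      rw [hs, Real.sqrt_mul hn0.le]
      ring
    rw [hgood, Set.mem_ofPred_eq, heq]
    linarith [(abs_le.1 h).1]
  have hnull : μ.real {ω | ¬ IsBinary (z ω)} = 0 := by
    rw [measureReal_def, ae_iff.1 hz.binary, ENNReal.toReal_zero]
  have h1 : (1 : ℝ) ≤ μ.real good + μ.real (⋃ q, bad q) + μ.real {ω | ¬ IsBinary (z ω)} := by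
    rw [← probReal_univ (μ := μ)]
    exact (measureReal_mono hcover).trans ((measureReal_union_le _ _).trans
      (by gcongr; exact measureReal_union_le _ _))
  linarith

end Rounding

end SmoothIP

/-! ### The main theorem -/

theorem mainTheorem1 {n d : ℕ} (hd : 2 ≤ d) {β : ℝ} (hβ : 0 < β)
    (p : MvPolynomial (Fin n) ℝ) (hp : SmoothIP.IsSmooth β d p)
    (P : List (Fin n) → MvPolynomial (Fin n) ℝ) (hP : SmoothIP.IsDecomposition β d p P)
    (xstar : Fin n → ℝ) (hxstar : SmoothIP.IsOptimalIP p xstar)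
    (xhat : Fin n → ℝ) (hxhat : SmoothIP.IsBinary xhat)
    (ε : ℝ) (hε : ε = SmoothIP.l1Error xhat xstar)
    (δ : List (Fin n) → ℝ)
    (hδ : δ = SmoothIP.relaxTolerance n d β ε ∨ δ = SmoothIP.deviationTolerance P xhat xstar)
    (y : Fin n → ℝ) (hy : SmoothIP.IsOptimalLP d P xhat δ y) :
    (∀ (k : ℝ) {Ω : Type*} [MeasurableSpace Ω] (μ : MeasureTheory.Measure Ω)
        [MeasureTheory.IsProbabilityMeasure μ] (z : Ω → Fin n → ℝ),
        SmoothIP.IsRandomizedRounding μ y z →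
        1 - 2 * (d : ℝ) / (n : ℝ) ^ (k - d + 2) ≤
          μ.real {ω | MvPolynomial.eval xstar p
              - 2 * SmoothIP.eta d * β * (n : ℝ) ^ ((d : ℝ) - 1 / 2) * √ε
              - SmoothIP.roundingConst d * β * (n : ℝ) ^ (d - 1) * √((k + 1) / 2)
                * √(n * Real.log n)
            ≤ MvPolynomial.eval (z ω) p}) ∧
    (SmoothIP.IsMultilinear p → ∀ z : Fin n → ℝ, SmoothIP.IsGreedyRounding p y z →
        MvPolynomial.eval xstar p
            - 2 * SmoothIP.eta d * β * (n : ℝ) ^ ((d : ℝ) - 1 / 2) * √ε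
          ≤ MvPolynomial.eval z p) := by
  subst hε
  have hd2 : (2 : ℝ) ≤ d := by exact_mod_cast hd
  have heta := SmoothIP.eta_nonneg hd
  refine ⟨fun k Ω _ μ _ z hz => ?_, fun hmul z hz => ?_⟩
  · rcases Nat.eq_zero_or_pos n with rfl | hn
    -- With no variables there is only one point, so the event is certain.
    · have huniv : ∀ ω, MvPolynomial.eval (z ω) p = MvPolynomial.eval xstar p := fun ω => by
        rw [Subsingleton.elim (z ω) xstar]
      have hpow : (0 : ℝ) ≤ 2 * (d : ℝ) / ((0 : ℕ) : ℝ) ^ (k - d + 2) := by positivity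
      have hd0 : (d : ℝ) - 1 / 2 ≠ 0 := by linarith
      simp only [huniv, Nat.cast_zero, Real.zero_rpow hd0, zero_mul, mul_zero, Real.sqrt_zero,
        sub_zero, le_refl, Set.ofPred_true, MeasureTheory.probReal_univ] at hpow ⊢
      linarith
    have hn1 : (1 : ℝ) ≤ n := by exact_mod_cast hn
    by_cases htriv : 1 - 2 * (d : ℝ) / (n : ℝ) ^ (k - d + 2) ≤ 0
    · exact htriv.trans MeasureTheory.measureReal_nonneg
    -- A positive probability bound forces this power above 1, which in turn gives both `2 ≤ n` and
    -- `0 ≤ k + 1`.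
    have hpow : 1 < (n : ℝ) ^ (k - d + 2) := by
      by_contra h
      refine htriv (sub_nonpos.2 ((one_le_div (by positivity)).2 ?_))
      linarith
    have hn2 : 2 ≤ n := by
      by_contra h
      obtain rfl : n = 1 := by omega
      simp at hpow
    have hk : 0 ≤ k + 1 := by
      by_contra h
      exact hpow.not_ge (Real.rpow_le_one_of_one_le_of_nonpos hn1 (by linarith))
    refine (hz.le_measureReal_eval hn2 hd hβ hP hy.1.1 hk).trans
      (MeasureTheory.measureReal_mono fun ω hω => ?_)
    have h := hP.eval_le_eval_add hn2 hd hβ.le hxhat hxstar.1 hδ hy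
    simp only [Set.mem_ofPred_eq] at hω ⊢
    linarith
  -- The value bound needs `2 ≤ n`; with at most one variable, greedy rounding already attains the
  -- integer optimum.
  · rcases le_or_gt n 1 with hn | hn
    · have h := hz.eval_le_of_le_one hn hxstar.1
      have : 0 ≤ 2 * SmoothIP.eta d * β * (n : ℝ) ^ ((d : ℝ) - 1 / 2) *
        √(SmoothIP.l1Error xhat xstar) := by positivity
      linarith
    · exact (hP.eval_le_eval_add hn hd hβ.le hxhat hxstar.1 hδ hy).trans (hz.eval_le hmul hy.1.1)
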